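/- Let $\nu$ be a finite positive Borel measure on $[0,1]$, let $\mathbb{D}$ be the open unit disk of $\mathbb{C}$ with normalized area measure $dA$, and let $$T_\nu f(z)=\int_{\mathbb{D}}\frac{1}{1-z\overline{\lambda}}\left(\int_{[0,1]}\frac{d\nu(r)}{1-rz\overline{\lambda}}\right)f(\lambda)\,dA(\lambda),\qquad z\in\mathbb{D}.$$ Put $$c_\nu=\sup\left\{1\le c<2:\ \int_{[0,1]}\frac{d\nu(r)}{(1-r^2)^{2/c'}}<\infty\right\},\qquad \frac1c+\frac1{c'}=1$$ (with $c'=\infty$ and $2/c'=0$ for $c=1$, the integrand then being $1$, and with the integrand equal to $\infty$ at $r=1$ for $c>1$), and let $c_\nu'$ be the dual index of $c_\nu$. For $1\le p<\infty$ let $L^{p,\infty}(\mathbb{D})$ be the space of measurable functions $g$ on $\mathbb{D}$ with $$\|g\|_{L^{p,\infty}}=\inf\{C>0:\ |\{z\in\mathbb{D}:|g(z)|>t\}|\le C^p/t^p\ \text{ for all } t>0\}<\infty,$$ where $|\cdot|$ is normalized area. That $T_\nu:L^1(\mathbb{D})\to L^{p,\infty}(\mathbb{D})$ is bounded means that there is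 a finite constant $C$ with $\|T_\nu f\|_{L^{p,\infty}}\le C\|f\|_{L^1(\mathbb{D})}$ for all $f\in L^1(\mathbb{D})$. Then: (a) If $1\le c_\nu<2$, then $T_\nu:L^1(\mathbb{D})\to L^{c_\nu,\infty}(\mathbb{D})$ is bounded if and only if $\nu$ satisfies the $2/c_\nu'$-Carleson condition $$\sup_{0<t\le1}\frac{\nu([1-t,1))}{t^{2/c_\nu'}}<\infty.$$ (b) If $c_\nu=2$, then $T_\nu:L^1(\mathbb{D})\to L^{2,\infty}(\mathbb{D})$ is bounded if and only if $$\int_{[0,1)}\frac{d\nu(r)}{1-r^2}<\infty.$$ -/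

import Mathlib

open MeasureTheory Set
open scoped ENNReal NNReal ComplexConjugate unitInterval

noncomputable section

namespace Shimorin

/-- The normalized area measure `dA` on the open unit disk of `ℂ` (total mass `1`), seen as a
measure on `ℂ` that vanishes off the disk. -/
def diskArea : Measure ℂ :=
  (ENNReal.ofReal Real.pi)⁻¹ • (volume : Measure ℂ).restrict (Metric.ball 0 1)

/-- The Shimorin-type kernel
`K_ν(z, w) = (1 - z w̄)⁻¹ ∫_{[0,1]} (1 - r z w̄)⁻¹ dν(r)`.
For `z`, `w` in the open disk the integrand is bounded and continuous in `r`. -/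
def kernel (ν : Measure I) (z w : ℂ) : ℂ :=
  1 / (1 - z * conj w) * ∫ r : I, 1 / (1 - ((r : ℝ) : ℂ) * z * conj w) ∂ν

/-- The Shimorin-type operator `T_ν f (z) = ∫_𝔻 K_ν(z, w) f(w) dA(w)`. For `z` in the open disk,
`w ↦ K_ν(z, w)` is bounded on the disk, so the integral converges for every `f ∈ L¹(𝔻)`. -/
def shimorinOp (ν : Measure I) (f : ℂ → ℂ) (z : ℂ) : ℂ :=
  ∫ w, kernel ν z w * f w ∂diskArea

/-- The dual index `c'` of `c ∈ [1, ∞)`, i.e. `1/c + 1/c' = 1`, with value `∞` at `c = 1`. -/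
def dualIndex (c : ℝ) : ℝ≥0∞ := ENNReal.conjExponent (ENNReal.ofReal c)

/-- The exponent `2 / c'`, a real number (it is `0` for `c = 1`). -/
def twoOverDual (c : ℝ) : ℝ := (2 / dualIndex c).toReal

/-- The critical index
`c_ν = sup {1 ≤ c < 2 : ∫_{[0,1]} (1 - r²)^(-2/c') dν(r) < ∞}`.
The integral is over the closed interval: the integrand is `∞` at `r = 1` when `c > 1`,
and it is constantly `1` when `c = 1`. -/
def criticalIndex (ν : Measure I) : ℝ :=
  sSup {c : ℝ | 1 ≤ c ∧ c < 2 ∧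
    ∫⁻ r : I, 1 / ENNReal.ofReal (1 - (r : ℝ) ^ 2) ^ twoOverDual c ∂ν < ∞}

/-- The weak `L^p(𝔻)` quasi-norm
`inf {C > 0 : |{z ∈ 𝔻 : |g(z)| > t}| ≤ C^p / t^p for all t > 0}` (equal to `∞` if no finite
`C` is admissible). -/
def weakNorm (p : ℝ) (g : ℂ → ℂ) : ℝ≥0∞ :=
  sInf {C : ℝ≥0∞ | 0 < C ∧ ∀ t : ℝ, 0 < t →
    diskArea {z | t < ‖g z‖} ≤ C ^ p / ENNReal.ofReal t ^ p}

/-- Boundedness of `T_ν : L¹(𝔻) → L^{p,∞}(𝔻)`. -/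
def WeakBounded (ν : Measure I) (p : ℝ) : Prop :=
  ∃ C : ℝ≥0, ∀ f : ℂ → ℂ, MemLp f 1 diskArea →
    AEStronglyMeasurable (shimorinOp ν f) diskArea ∧
      weakNorm p (shimorinOp ν f) ≤ C * eLpNorm f 1 diskArea

/-- The `α`-Carleson condition `sup_{0 < t ≤ 1} ν([1 - t, 1)) / t^α < ∞`. -/
def IsCarleson (ν : Measure I) (α : ℝ) : Prop :=
  ⨆ t ∈ Ioc (0 : ℝ) 1,
    ν {r : I | 1 - t ≤ (r : ℝ) ∧ (r : ℝ) < 1} / ENNReal.ofReal (t ^ α) < ∞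

/-- Integrability with respect to the hyperbolic arc length: `∫_{[0,1)} dν(r)/(1 - r²) < ∞`. -/
def HyperbolicIntegrable (ν : Measure I) : Prop :=
  ∫⁻ r in {r : I | (r : ℝ) < 1}, 1 / ENNReal.ofReal (1 - (r : ℝ) ^ 2) ∂ν < ∞

end Shimorin

end

namespace Shimorin

/-! Throughout, `T_ν` is compared with the potential of the kernel `|1 - z w̄|^(-2/p)`, where `p =
c_ν`.

Sufficiency: `|1 - r z w̄|` dominates both `1 - r` and, up to a factor 2, `|1 - z w̄|`, so the
condition on `ν` gives `|K_ν(z, w)| ≲ |1 - z w̄|^(-2/p)`. If `p > 1`, the sets `{z : |1 - z w̄| <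
s}` have area at most `4 s²`, hence this kernel lies in weak `L^p` uniformly in `w`, and Fubini over
the set where `|T_ν f| > t` gives the weak bound (`weakBounded_of_kernel_le`). If `p = 1`, weak `L¹`
is not normable; `exists_subset_setLIntegral_sqKernel_le` instead passes to a subset of at least
half the measure whose potential is bounded. It rests on a bound `4 |E|` for the integral of `|1 - z
w̄|⁻²` over `E × E`, on Chebyshev, and on a maximum principle. So `T_ν` is always of weak type
(1,1).

Necessity: `T_ν` is tested on the indicator of the disc of radius `s/16` about `1 - s`, where `Re
K_ν` is at least `(8s)⁻¹ ∫ dν(r)/(1 - r + 2s)` (`le_re_kernel`). Weak boundedness then forces this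
integral to be `O(s^(1 - 2/p))`. Chebyshev turns this into the Carleson condition; for `p = 2`,
Fatou as `s → 0` gives hyperbolic integrability.

Both conditions on `ν` ignore the point `r = 1`. The definition of `c_ν` enters only through the
fact that `c_ν > 1` forces `ν({1}) = 0`. -/

/-! ### Normalized area -/

instance isFiniteMeasure_diskArea : IsFiniteMeasure diskArea := by
  refine ⟨?_⟩
  rw [diskArea, Measure.smul_apply, smul_eq_mul, Measure.restrict_apply_univ, Complex.volume_ball]
  refine ENNReal.mul_lt_top (ENNReal.inv_lt_top.2 (by simp [Real.pi_pos])) ?_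
  exact ENNReal.mul_lt_top (by simp) ENNReal.coe_lt_top

theorem ae_mem_ball_diskArea : ∀ᵐ z ∂diskArea, z ∈ Metric.ball (0 : ℂ) 1 :=
  Measure.ae_smul_measure (ae_restrict_mem Metric.isOpen_ball.measurableSet) _

theorem diskArea_apply_le {s : Set ℂ} (hs : MeasurableSet s) :
    diskArea s ≤ (ENNReal.ofReal Real.pi)⁻¹ * volume s := by
  rw [diskArea, Measure.smul_apply, smul_eq_mul, Measure.restrict_apply hs]
  gcongr
  exact inter_subset_left

theorem diskArea_ball_le (a : ℂ) {R : ℝ} (hR : 0 ≤ R) :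
    diskArea (Metric.ball a R) ≤ ENNReal.ofReal (R ^ 2) := by
  refine (diskArea_apply_le measurableSet_ball).trans (le_of_eq ?_)
  have hpi : (NNReal.pi : ℝ≥0∞) = ENNReal.ofReal Real.pi := by
    rw [← NNReal.coe_real_pi, ENNReal.ofReal_coe_nnreal]
  rw [Complex.volume_ball, hpi, mul_comm _ (ENNReal.ofReal Real.pi), ← mul_assoc,
    ENNReal.inv_mul_cancel (by simp [Real.pi_pos]) ENNReal.ofReal_ne_top, one_mul,
    ENNReal.ofReal_pow hR]

theorem diskArea_ball_eq {a : ℂ} {R : ℝ} (hR : 0 ≤ R)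
    (h : Metric.ball a R ⊆ Metric.ball 0 1) :
    diskArea (Metric.ball a R) = ENNReal.ofReal (R ^ 2) := by
  have hpi : (NNReal.pi : ℝ≥0∞) = ENNReal.ofReal Real.pi := by
    rw [← NNReal.coe_real_pi, ENNReal.ofReal_coe_nnreal]
  rw [diskArea, Measure.smul_apply, smul_eq_mul, Measure.restrict_apply measurableSet_ball,
    inter_eq_left.2 h, Complex.volume_ball, hpi, mul_comm _ (ENNReal.ofReal Real.pi), ← mul_assoc,
    ENNReal.inv_mul_cancel (by simp [Real.pi_pos]) ENNReal.ofReal_ne_top, one_mul,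
    ENNReal.ofReal_pow hR]

/-! ### Geometry of `|1 - z w̄|` -/

theorem norm_mul_conj_lt_one {z w : ℂ} (hz : z ∈ Metric.ball (0 : ℂ) 1)
    (hw : w ∈ Metric.ball (0 : ℂ) 1) : ‖z * conj w‖ < 1 := by
  rw [mem_ball_zero_iff] at hz hw
  rw [norm_mul, RCLike.norm_conj]
  exact mul_lt_one_of_nonneg_of_lt_one_left (norm_nonneg _) hz hw.le

theorem one_sub_ne_zero {ζ : ℂ} (h : ‖ζ‖ < 1) : 1 - ζ ≠ 0 := by
  intro h0
  rw [← sub_eq_zero.1 h0] at h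
  simp at h

/-- The difference of the squares is `(1 - |z|²)(1 - |w|²) ≥ 0`. -/
theorem norm_sub_le_norm_one_sub_mul_conj {z w : ℂ} (hz : z ∈ Metric.ball (0 : ℂ) 1)
    (hw : w ∈ Metric.ball (0 : ℂ) 1) : ‖z - w‖ ≤ ‖1 - z * conj w‖ := by
  rw [mem_ball_zero_iff] at hz hw
  have h1 : ‖z‖ ^ 2 ≤ 1 := by nlinarith [norm_nonneg z]
  have h2 : ‖w‖ ^ 2 ≤ 1 := by nlinarith [norm_nonneg w]
  rw [← Complex.normSq_eq_norm_sq, Complex.normSq_apply] at h1 h2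
  refine le_of_sq_le_sq ?_ (norm_nonneg _)
  simp only [← Complex.normSq_eq_norm_sq, Complex.normSq_apply, Complex.sub_re, Complex.sub_im,
    Complex.mul_re, Complex.mul_im, Complex.conj_re, Complex.conj_im, Complex.one_re,
    Complex.one_im]
  nlinarith [mul_nonneg (sub_nonneg.2 h1) (sub_nonneg.2 h2)]

theorem norm_one_sub_mul_conj_comm (z w : ℂ) : ‖1 - z * conj w‖ = ‖1 - w * conj z‖ := by
  rw [← RCLike.norm_conj (1 - z * conj w)]
  simp [mul_comm]

/-- `|1 - z w̄|` satisfies the triangle inequality on the disk. -/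
theorem norm_one_sub_mul_conj_triangle {z w v : ℂ} (hz : z ∈ Metric.ball (0 : ℂ) 1)
    (hw : w ∈ Metric.ball (0 : ℂ) 1) (hv : v ∈ Metric.ball (0 : ℂ) 1) :
    ‖1 - z * conj v‖ ≤ ‖1 - z * conj w‖ + ‖1 - w * conj v‖ := by
  have h : 1 - z * conj v = (1 - z * conj w) + z * conj (w - v) := by
    rw [map_sub]; ring
  rw [h]
  refine (norm_add_le _ _).trans ?_
  gcongr
  rw [norm_mul, RCLike.norm_conj]
  rw [mem_ball_zero_iff] at hz
  exact (mul_le_of_le_one_left (norm_nonneg _) hz.le).trans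
    (norm_sub_le_norm_one_sub_mul_conj hw hv)

theorem one_sub_le_norm_one_sub_mul {ζ : ℂ} (h : ‖ζ‖ ≤ 1) {r : ℝ} (h0 : 0 ≤ r) :
    1 - r ≤ ‖1 - (r : ℂ) * ζ‖ := by
  have := norm_sub_norm_le (1 : ℂ) ((r : ℂ) * ζ)
  rw [norm_mul, Complex.norm_real, Real.norm_of_nonneg h0, norm_one] at this
  nlinarith

theorem norm_one_sub_le_two_mul {ζ : ℂ} (h : ‖ζ‖ ≤ 1) {r : ℝ} (h0 : 0 ≤ r) (h1 : r ≤ 1) :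
    ‖1 - ζ‖ ≤ 2 * ‖1 - (r : ℂ) * ζ‖ := by
  have h2 : 1 - ζ = (1 - (r : ℂ) * ζ) + -(((1 - r : ℝ) : ℂ) * ζ) := by push_cast; ring
  have h3 := norm_add_le (1 - (r : ℂ) * ζ) (-(((1 - r : ℝ) : ℂ) * ζ))
  rw [← h2, norm_neg, norm_mul, Complex.norm_real, Real.norm_of_nonneg (by linarith)] at h3
  nlinarith [one_sub_le_norm_one_sub_mul h h0]

theorem diskArea_setOf_norm_one_sub_lt_le {w : ℂ} (hw : w ∈ Metric.ball (0 : ℂ) 1) {s : ℝ}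
    (hs : 0 ≤ s) :
    diskArea {z | ‖1 - z * conj w‖ < s} ≤ ENNReal.ofReal (4 * s ^ 2) := by
  rw [mem_ball_zero_iff] at hw
  have h4 : 4 * s ^ 2 = (2 * s) ^ 2 := by ring
  rw [h4]
  -- The set is a disc of radius `s/|w|` about `1/w̄`, which is good enough when `|w| ≥ 1/2`.
  -- Otherwise `|1 - z w̄| > 1/2` on the disk: the set is null for `s ≤ 1/2`, and for larger `s` the
  -- bound exceeds the total area.
  rcases le_or_gt (1 / 2) ‖w‖ with h | h
  · refine (measure_mono ?_).trans (diskArea_ball_le (conj w)⁻¹ (by positivity))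
    intro z hz
    have hw0 : conj w ≠ 0 := by
      rw [← norm_pos_iff, RCLike.norm_conj]; linarith
    have h5 : 1 - z * conj w = ((conj w)⁻¹ - z) * conj w := by
      rw [sub_mul, inv_mul_cancel₀ hw0]
    rw [mem_ofPred_eq, h5, norm_mul, RCLike.norm_conj] at hz
    rw [Metric.mem_ball, dist_comm, dist_eq_norm]
    nlinarith [norm_nonneg ((conj w)⁻¹ - z)]
  · rcases le_or_gt s (1 / 2) with h' | h'
    · refine (measure_mono_null ?_ (ae_iff.1 ae_mem_ball_diskArea)).trans_le zero_le
      intro z hz hz'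
      rw [mem_ball_zero_iff] at hz'
      rw [mem_ofPred_eq] at hz
      have := norm_sub_norm_le (1 : ℂ) (z * conj w)
      rw [norm_mul, RCLike.norm_conj, norm_one] at this
      nlinarith [norm_nonneg z, norm_nonneg w]
    · have h1 : {z : ℂ | ‖1 - z * conj w‖ < s} ≤ᵐ[diskArea] Metric.ball (0 : ℂ) 1 := by
        filter_upwards [ae_mem_ball_diskArea] with z hz _ using hz
      refine (measure_mono_ae h1).trans ((diskArea_ball_le 0 zero_le_one).trans ?_)
      exact ENNReal.ofReal_le_ofReal (by nlinarith)

/-! ### Poisson integrals -/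

/-- The Poisson kernel reproduces the constant function 1. -/
theorem lintegral_poisson {a : ℂ} (ha : ‖a‖ < 1) :
    ∫⁻ θ in Ioo (-Real.pi) Real.pi,
      ENNReal.ofReal (1 / ‖circleMap 0 1 θ - a‖ ^ 2) =
        ENNReal.ofReal (2 * Real.pi / (1 - ‖a‖ ^ 2)) := by
  have hne : ∀ θ, circleMap 0 1 θ - a ≠ 0 := fun θ h ↦ by
    rw [← sub_eq_zero.1 h] at ha
    simp at ha
  have hcont : Continuous fun θ ↦ 1 / ‖circleMap 0 1 θ - a‖ ^ 2 := by
    refine continuous_const.div (by fun_prop) fun θ ↦ ?_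
    exact pow_ne_zero _ (norm_ne_zero_iff.2 (hne θ))
  have hpos : 0 < 1 - ‖a‖ ^ 2 := by nlinarith [norm_nonneg a]
  have h := DiffContOnCl.circleAverage_poissonKernel_smul' (c := 0) (R := 1) (w := a)
    (f := fun _ ↦ (1 : ℂ)) diffContOnCl_const (by simpa using ha)
  rw [Real.circleAverage_def] at h
  have hint : (fun θ ↦ ((‖circleMap 0 1 θ - 0‖ ^ 2 - ‖a - 0‖ ^ 2) /
      ‖circleMap 0 1 θ - 0 - (a - 0)‖ ^ 2) • (1 : ℂ)) =
      fun θ ↦ (((1 - ‖a‖ ^ 2) * (1 / ‖circleMap 0 1 θ - a‖ ^ 2) : ℝ) : ℂ) := by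
    funext θ
    simp [div_eq_mul_inv]
  rw [hint, intervalIntegral.integral_ofReal, intervalIntegral.integral_const_mul,
    Complex.real_smul, ← Complex.ofReal_mul, ← Complex.ofReal_one, Complex.ofReal_inj] at h
  have hper : Function.Periodic (fun θ ↦ 1 / ‖circleMap 0 1 θ - a‖ ^ 2) (2 * Real.pi) :=
    fun θ ↦ by simp only [periodic_circleMap 0 1 θ]
  have hshift := hper.intervalIntegral_add_eq 0 (-Real.pi)
  rw [zero_add, show -Real.pi + 2 * Real.pi = Real.pi by ring] at hshift
  have hle : -Real.pi ≤ Real.pi := by linarith [Real.pi_pos]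
  rw [hshift, intervalIntegral.integral_of_le hle] at h
  rw [setLIntegral_congr Ioo_ae_eq_Ioc, ← ofReal_integral_eq_lintegral_ofReal]
  · congr 1
    rw [eq_div_iff hpos.ne']
    have := Real.pi_pos
    field_simp at h
    linarith
  · exact (hcont.intervalIntegrable _ _).1
  · exact Filter.Eventually.of_forall fun θ ↦ by positivity

/-- The part of the disk outside the radius of `z` contributes a bounded amount to the
integral of `|1 - z w̄|⁻²`. -/
theorem lintegral_norm_one_sub_inv_sq_le {z : ℂ} (hz : z ∈ Metric.ball (0 : ℂ) 1) :
    ∫⁻ w in {w | ‖z‖ ≤ ‖w‖}, ENNReal.ofReal (1 / ‖1 - z * conj w‖ ^ 2) ∂diskArea ≤ 2 := by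
  rw [mem_ball_zero_iff] at hz
  have hS : MeasurableSet {w : ℂ | ‖z‖ ≤ ‖w‖} := measurableSet_le measurable_const measurable_norm
  have hT : MeasurableSet ({w : ℂ | ‖z‖ ≤ ‖w‖} ∩ Metric.ball 0 1) := hS.inter measurableSet_ball
  set G : ℂ → ℝ≥0∞ := ({w : ℂ | ‖z‖ ≤ ‖w‖} ∩ Metric.ball 0 1).indicator
    fun w ↦ ENNReal.ofReal (1 / ‖1 - z * conj w‖ ^ 2) with hG
  have hGm : Measurable G := by
    refine Measurable.indicator ?_ hT
    have : Measurable fun w : ℂ ↦ 1 - z * conj w :=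
      (by fun_prop : Continuous fun w : ℂ ↦ 1 - z * conj w).measurable
    fun_prop
  have hkey : ∫⁻ w, G w ≤ ENNReal.ofReal (2 * Real.pi) := by
    rw [← Complex.lintegral_comp_polarCoord_symm, polarCoord_target, Measure.volume_eq_prod,
      ← Measure.prod_restrict, lintegral_prod]
    · have hinner : ∀ ρ : ℝ, ρ ∈ Ioi (0 : ℝ) →
          ∫⁻ θ in Ioo (-Real.pi) Real.pi,
            ENNReal.ofReal ρ • G (Complex.polarCoord.symm (ρ, θ)) ≤
          (Ico ‖z‖ 1).indicator (fun _ ↦ ENNReal.ofReal (2 * Real.pi / (1 - ‖z‖))) ρ := by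
        intro ρ hρ
        rw [mem_Ioi] at hρ
        have hpolar : ∀ θ : ℝ, Complex.polarCoord.symm (ρ, θ) = ρ * circleMap 0 1 θ := by
          intro θ
          rw [Complex.polarCoord_symm_apply, circleMap_zero, Complex.exp_mul_I]
          simp
        have hnorm : ∀ θ : ℝ, ‖(ρ : ℂ) * circleMap 0 1 θ‖ = ρ := by
          intro θ
          simp [abs_of_pos hρ]
        by_cases hmem : ρ ∈ Ico ‖z‖ 1
        · rw [indicator_of_mem hmem]
          have hzρ : ‖z * ρ‖ = ‖z‖ * ρ := by
            rw [norm_mul, Complex.norm_real, Real.norm_of_nonneg hρ.le]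
          have hlt : ‖z * ρ‖ < 1 := by
            rw [hzρ]; nlinarith [hmem.2, norm_nonneg z]
          have heq : ∀ θ : ℝ, ENNReal.ofReal ρ • G (Complex.polarCoord.symm (ρ, θ)) ≤
              ENNReal.ofReal (1 / ‖circleMap 0 1 θ - z * ρ‖ ^ 2) := by
            intro θ
            rw [hpolar, hG, indicator_of_mem (by
              simp only [mem_inter_iff, mem_ofPred_eq, mem_ball_zero_iff, hnorm]; exact hmem)]
            -- Multiplying by the unimodular `e^{iθ}` produces the Poisson denominator with pole
            -- parameter `zρ`.
            have h1 : ‖1 - z * conj ((ρ : ℂ) * circleMap 0 1 θ)‖ = ‖circleMap 0 1 θ - z * ρ‖ := by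
              have h2 : conj (circleMap 0 1 θ) * circleMap 0 1 θ = 1 := by
                rw [← Complex.normSq_eq_conj_mul_self, Complex.normSq_eq_norm_sq]
                simp
              have h3 : circleMap 0 1 θ - z * ρ =
                  (1 - z * conj ((ρ : ℂ) * circleMap 0 1 θ)) * circleMap 0 1 θ := by
                rw [map_mul, Complex.conj_ofReal]
                linear_combination (z * ρ) * h2
              rw [h3, norm_mul]
              simp
            rw [h1, smul_eq_mul]
            refine mul_le_of_le_one_left zero_le ?_
            rw [ENNReal.ofReal_le_one]
            exact hmem.2.le
          refine (lintegral_mono heq).trans ?_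
          rw [lintegral_poisson hlt]
          refine ENNReal.ofReal_le_ofReal ?_
          have := Real.pi_pos
          gcongr
          rw [hzρ]
          have h5 : ‖z‖ * ρ ≤ ‖z‖ := mul_le_of_le_one_right (norm_nonneg z) hmem.2.le
          nlinarith [norm_nonneg z, mul_nonneg (norm_nonneg z) hρ.le]
        · rw [indicator_of_notMem hmem, nonpos_iff_eq_zero]
          refine lintegral_eq_zero_of_ae_eq_zero (Filter.Eventually.of_forall fun θ ↦ ?_)
          simp only [hpolar]
          rw [hG, indicator_of_notMem]
          · simp
          · simp only [mem_inter_iff, mem_ofPred_eq, mem_ball_zero_iff, hnorm]; exact hmem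
      refine (setLIntegral_mono' measurableSet_Ioi hinner).trans ?_
      refine (setLIntegral_le_lintegral _ _).trans ?_
      -- The radii fill an interval of length `1 - |z|`, which cancels the factor `1/(1 - |z|)`;
      -- over the whole disk a logarithm would appear.
      rw [lintegral_indicator measurableSet_Ico, setLIntegral_const, Real.volume_Ico,
        ← ENNReal.ofReal_mul]
      · refine ENNReal.ofReal_le_ofReal ?_
        have : (1 - ‖z‖) ≠ 0 := by linarith
        rw [div_mul_cancel₀ _ this]
      · have := Real.pi_pos
        have : 0 < 1 - ‖z‖ := by linarith
        positivity
    · refine Measurable.aemeasurable ?_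
      have h1 : Measurable fun p : ℝ × ℝ ↦ Complex.polarCoord.symm p := by
        simp_rw [Complex.polarCoord_symm_apply]
        fun_prop
      exact (ENNReal.measurable_ofReal.comp measurable_fst).smul (hGm.comp h1)
  rw [diskArea, Measure.restrict_smul, lintegral_smul_measure, Measure.restrict_restrict hS,
    ← lintegral_indicator hT, smul_eq_mul]
  calc _ ≤ (ENNReal.ofReal Real.pi)⁻¹ * ENNReal.ofReal (2 * Real.pi) := by gcongr
    _ = 2 := by
      rw [mul_comm 2, ENNReal.ofReal_mul Real.pi_pos.le, ← mul_assoc,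
        ENNReal.inv_mul_cancel (by simp [Real.pi_pos]) ENNReal.ofReal_ne_top, one_mul]
      simp

/-! ### Weak-type kernels for `p > 1` -/

theorem measurable_norm_one_sub_rpow (q : ℝ) :
    Measurable fun p : ℂ × ℂ ↦ ENNReal.ofReal (‖1 - p.1 * conj p.2‖ ^ q) := by
  have : Measurable fun p : ℂ × ℂ ↦ 1 - p.1 * conj p.2 :=
    (by fun_prop : Continuous fun p : ℂ × ℂ ↦ 1 - p.1 * conj p.2).measurable
  exact (this.norm.pow_const q).ennreal_ofReal

/-- If `g` is in weak `L^p` with `p > 1`, its integrals over sets of given measure are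
controlled. -/
theorem setLIntegral_ofReal_le_of_meas_lt_le {α : Type*} [MeasurableSpace α] {μ : Measure α}
    [IsFiniteMeasure μ] {p B : ℝ} (hp : 1 < p) (hB : 0 ≤ B) {g : α → ℝ} (hg0 : ∀ x, 0 ≤ g x)
    (hg : Measurable g)
    (h : ∀ t, 0 < t → μ {x | t < g x} ≤ ENNReal.ofReal (B * t ^ (-p))) (E : Set α) :
    ∫⁻ x in E, ENNReal.ofReal (g x) ∂μ ≤ ENNReal.ofReal (1 + B / (p - 1)) * μ E ^ (1 - 1 / p) := by
  rcases eq_or_ne (μ E) 0 with h0 | h0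
  · rw [Measure.restrict_eq_zero.2 h0]; simp
  set m : ℝ := (μ E).toReal with hm
  have hm0 : 0 < m := ENNReal.toReal_pos h0 (measure_ne_top _ _)
  have hmE : μ E = ENNReal.ofReal m := (ENNReal.ofReal_toReal (measure_ne_top _ _)).symm
  -- At this height `T^(-p) = m`, so the trivial bound by `μ E` and the weak-type bound balance.
  set T : ℝ := m ^ (-(1 / p)) with hT
  have hT0 : 0 < T := Real.rpow_pos_of_pos hm0 _
  rw [lintegral_eq_lintegral_meas_lt _ (Filter.Eventually.of_forall hg0) hg.aemeasurable,
    ← Ioc_union_Ioi_eq_Ioi hT0.le, lintegral_union measurableSet_Ioi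
      (Ioc_disjoint_Ioi le_rfl)]
  have h1 : ∫⁻ t in Ioc 0 T, (μ.restrict E) {x | t < g x} ≤ ENNReal.ofReal (m ^ (1 - 1 / p)) := by
    calc _ ≤ ∫⁻ t in Ioc 0 T, μ E := by
          refine lintegral_mono fun t ↦ ?_
          exact (measure_mono (subset_univ _)).trans (by simp)
      _ = ENNReal.ofReal (m ^ (1 - 1 / p)) := by
          rw [setLIntegral_const, Real.volume_Ioc, hmE, ← ENNReal.ofReal_mul hm0.le, sub_zero, hT,
            sub_eq_add_neg, Real.rpow_add hm0, Real.rpow_one]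
  have h2 : ∫⁻ t in Ioi T, (μ.restrict E) {x | t < g x} ≤
      ENNReal.ofReal (B / (p - 1) * m ^ (1 - 1 / p)) := by
    calc _ ≤ ∫⁻ t in Ioi T, ENNReal.ofReal (B * t ^ (-p)) := by
          refine setLIntegral_mono' measurableSet_Ioi fun t ht ↦ ?_
          exact (Measure.restrict_apply_le _ _).trans (h t (hT0.trans ht))
      _ = ENNReal.ofReal (∫ t in Ioi T, B * t ^ (-p)) := by
          rw [ofReal_integral_eq_lintegral_ofReal]
          · exact (integrableOn_Ioi_rpow_of_lt (by linarith) hT0).const_mul B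
          · filter_upwards [ae_restrict_mem measurableSet_Ioi] with t ht
            have : 0 < t := hT0.trans ht
            positivity
      _ = _ := by
          rw [integral_const_mul, integral_Ioi_rpow_of_lt (by linarith) hT0, hT,
            ← Real.rpow_mul hm0.le]
          have e1 : -(1 / p) * (-p + 1) = 1 - 1 / p := by
            have : p ≠ 0 := by linarith
            field_simp
            ring
          have e2 : -p + 1 = -(p - 1) := by ring
          rw [e1, e2, neg_div_neg_eq, mul_div_assoc', div_mul_eq_mul_div]
  refine (add_le_add h1 h2).trans (le_of_eq ?_)
  have hp1 : 0 < p - 1 := by linarith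
  rw [← ENNReal.ofReal_add (by positivity) (by positivity), hmE,
    ENNReal.ofReal_rpow_of_pos hm0, ← ENNReal.ofReal_mul (by positivity)]
  congr 1
  ring

theorem setLIntegral_norm_one_sub_rpow_le {p : ℝ} (hp : 1 < p) {w : ℂ}
    (hw : w ∈ Metric.ball (0 : ℂ) 1) (E : Set ℂ) :
    ∫⁻ z in E, ENNReal.ofReal (‖1 - z * conj w‖ ^ (-(2 / p))) ∂diskArea ≤
      ENNReal.ofReal (1 + 4 / (p - 1)) * diskArea E ^ (1 - 1 / p) := by
  have hp0 : 0 < p := by linarith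
  refine setLIntegral_ofReal_le_of_meas_lt_le hp (by norm_num) (fun z ↦ by positivity) ?_ ?_ E
  · have : Measurable fun z : ℂ ↦ 1 - z * conj w :=
      (by fun_prop : Continuous fun z : ℂ ↦ 1 - z * conj w).measurable
    exact this.norm.pow_const _
  · intro t ht
    have h1 := diskArea_setOf_norm_one_sub_lt_le hw (s := t ^ (-(p / 2))) (by positivity)
    have h2 : 4 * (t ^ (-(p / 2))) ^ 2 = 4 * t ^ (-p) := by
      rw [← Real.rpow_natCast, ← Real.rpow_mul ht.le]
      congr 2; push_cast; ring
    rw [h2] at h1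
    refine (measure_mono_ae ?_).trans h1
    filter_upwards [ae_mem_ball_diskArea] with z hz hlt
    have hd : 0 < ‖1 - z * conj w‖ :=
      norm_pos_iff.2 (one_sub_ne_zero (norm_mul_conj_lt_one hz hw))
    have hlt' : t < ‖1 - z * conj w‖ ^ (-(2 / p)) := hlt
    change ‖1 - z * conj w‖ < t ^ (-(p / 2))
    have h3 := Real.rpow_lt_rpow_of_neg ht hlt' (z := -(p / 2)) (by linarith)
    rwa [← Real.rpow_mul hd.le, show -(2 / p) * -(p / 2) = 1 by field_simp, Real.rpow_one] at h3

/-! ### Bounded potentials on large subsets, for `p = 1` -/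

/-- The kernel `|1 - z w̄|⁻²`. -/
noncomputable def sqKernel (z w : ℂ) : ℝ≥0∞ := ENNReal.ofReal (‖1 - z * conj w‖ ^ (-2 : ℝ))

theorem measurable_sqKernel : Measurable fun p : ℂ × ℂ ↦ sqKernel p.1 p.2 :=
  measurable_norm_one_sub_rpow _

theorem measurable_sqKernel_left (w : ℂ) : Measurable fun z ↦ sqKernel z w :=
  Measurable.of_uncurry_right measurable_sqKernel

theorem sqKernel_comm (z w : ℂ) : sqKernel z w = sqKernel w z := by
  rw [sqKernel, sqKernel, norm_one_sub_mul_conj_comm]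

theorem lintegral_sqKernel_le {z : ℂ} (hz : z ∈ Metric.ball (0 : ℂ) 1) :
    ∫⁻ w in {w | ‖z‖ ≤ ‖w‖}, sqKernel w z ∂diskArea ≤ 2 := by
  refine le_trans (le_of_eq ?_) (lintegral_norm_one_sub_inv_sq_le hz)
  refine lintegral_congr fun w ↦ ?_
  rw [sqKernel_comm, sqKernel, Real.rpow_neg (norm_nonneg _), one_div]
  norm_cast

/-- By symmetry the double integral splits according to which variable has the larger modulus.
Integrating that variable first costs at most 2 in each half. -/
theorem setLIntegral_setLIntegral_sqKernel_le (E : Set ℂ) :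
    ∫⁻ w in E, ∫⁻ z in E, sqKernel z w ∂diskArea ∂diskArea ≤ 4 * diskArea E := by
  set D : Set (ℂ × ℂ) := {p | ‖p.1‖ ≤ ‖p.2‖} with hD
  have hDm : MeasurableSet D := measurableSet_le measurable_fst.norm measurable_snd.norm
  set a : ℂ → ℂ → ℝ≥0∞ := fun z w ↦ {w | ‖z‖ ≤ ‖w‖}.indicator (fun w ↦ sqKernel w z) w with ha
  have ham : Measurable fun p : ℂ × ℂ ↦ a p.1 p.2 :=
    (measurable_sqKernel.comp measurable_swap).indicator hDm
  have hle : ∀ z w, sqKernel z w ≤ a z w + a w z := by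
    intro z w
    rcases le_total ‖z‖ ‖w‖ with h | h
    · refine le_trans ?_ le_self_add
      simp only [ha]
      rw [indicator_of_mem (by exact h), sqKernel_comm]
    · refine le_trans ?_ le_add_self
      simp only [ha]
      rw [indicator_of_mem (by exact h)]
  have hA : ∫⁻ z in E, ∫⁻ w in E, a z w ∂diskArea ∂diskArea ≤ 2 * diskArea E := by
    calc _ ≤ ∫⁻ z in E, 2 ∂diskArea := by
          refine lintegral_mono_ae ?_
          filter_upwards [ae_restrict_of_ae ae_mem_ball_diskArea] with z hz
          refine le_trans ?_ (lintegral_sqKernel_le hz)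
          rw [← lintegral_indicator (measurableSet_le measurable_const measurable_norm)]
          exact setLIntegral_le_lintegral _ _
      _ = _ := by rw [setLIntegral_const]
  calc _ ≤ ∫⁻ w in E, ((∫⁻ z in E, a z w ∂diskArea) + ∫⁻ z in E, a w z ∂diskArea) ∂diskArea := by
        refine lintegral_mono fun w ↦ ?_
        have hm : Measurable fun z ↦ a w z := ham.comp (measurable_const.prodMk measurable_id)
        rw [← lintegral_add_right _ hm]
        exact lintegral_mono fun z ↦ hle z w
    _ = (∫⁻ w in E, ∫⁻ z in E, a z w ∂diskArea ∂diskArea) +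
          ∫⁻ w in E, ∫⁻ z in E, a w z ∂diskArea ∂diskArea :=
        lintegral_add_right _ ham.lintegral_prod_right'
    _ ≤ 2 * diskArea E + 2 * diskArea E := by
        refine add_le_add ?_ hA
        rw [lintegral_lintegral_swap]
        · exact hA
        · exact (ham.comp measurable_swap).aemeasurable
    _ = 4 * diskArea E := by rw [← add_mul]; norm_num

/-- An almost nearest point of `E` to `w`. The infimum need not be attained, but it is positive, so
any factor above 1 would do. -/
theorem exists_mem_norm_one_sub_mul_conj_le {E : Set ℂ} (hE : E.Nonempty)
    (hE1 : E ⊆ Metric.ball 0 1) {w : ℂ} (hw : w ∈ Metric.ball (0 : ℂ) 1) :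
    ∃ v ∈ E, ∀ z ∈ E, ‖1 - v * conj w‖ ≤ 3 * ‖1 - z * conj w‖ := by
  set S : Set ℝ := (fun z ↦ ‖1 - z * conj w‖) '' E with hS
  have hne : S.Nonempty := hE.image _
  rw [mem_ball_zero_iff] at hw
  have hlb : ∀ x ∈ S, 1 - ‖w‖ ≤ x := by
    rintro _ ⟨z, hz, rfl⟩
    have h1 := norm_sub_norm_le (1 : ℂ) (z * conj w)
    have h2 := mem_ball_zero_iff.1 (hE1 hz)
    rw [norm_mul, RCLike.norm_conj, norm_one] at h1
    nlinarith [norm_nonneg z, norm_nonneg w]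
  have hpos : 0 < sInf S := lt_of_lt_of_le (by linarith) (le_csInf hne hlb)
  obtain ⟨_, ⟨v, hv, rfl⟩, hlt⟩ := exists_lt_of_csInf_lt hne (by linarith : sInf S < 3 * sInf S)
  refine ⟨v, hv, fun z hz ↦ hlt.le.trans ?_⟩
  have : sInf S ≤ ‖1 - z * conj w‖ := csInf_le ⟨_, hlb⟩ ⟨z, hz, rfl⟩
  linarith

/-- Maximum principle: potentials that are bounded on the support are bounded everywhere. -/
theorem setLIntegral_sqKernel_le_of_forall_mem {E : Set ℂ} (hE : MeasurableSet E)
    (hE1 : E ⊆ Metric.ball 0 1) {C : ℝ≥0∞}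
    (hC : ∀ v ∈ E, ∫⁻ z in E, sqKernel z v ∂diskArea ≤ C) {w : ℂ}
    (hw : w ∈ Metric.ball (0 : ℂ) 1) : ∫⁻ z in E, sqKernel z w ∂diskArea ≤ 16 * C := by
  rcases eq_empty_or_nonempty E with h0 | h0
  · rw [h0]; simp
  obtain ⟨v, hv, hvmin⟩ := exists_mem_norm_one_sub_mul_conj_le h0 hE1 hw
  have hcomp : ∀ z ∈ E, sqKernel z w ≤ 16 * sqKernel z v := by
    intro z hz
    -- Triangle inequality through `w`: `4 = 1 + 3`, and squaring yields the 16.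
    have h1 : ‖1 - z * conj v‖ ≤ 4 * ‖1 - z * conj w‖ := by
      have := norm_one_sub_mul_conj_triangle (hE1 hz) hw (hE1 hv)
      have h2 := hvmin z hz
      rw [norm_one_sub_mul_conj_comm] at h2
      linarith
    have h2 : 0 < ‖1 - z * conj v‖ :=
      norm_pos_iff.2 (one_sub_ne_zero (norm_mul_conj_lt_one (hE1 hz) (hE1 hv)))
    have h3 : 0 < ‖1 - z * conj w‖ :=
      norm_pos_iff.2 (one_sub_ne_zero (norm_mul_conj_lt_one (hE1 hz) hw))
    have h4 : ‖1 - z * conj w‖ ^ (-2 : ℝ) ≤ 16 * ‖1 - z * conj v‖ ^ (-2 : ℝ) := by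
      rw [Real.rpow_neg h3.le, Real.rpow_neg h2.le, Real.rpow_two, Real.rpow_two,
        ← div_eq_mul_inv, inv_eq_one_div, div_le_div_iff₀ (pow_pos h3 2) (pow_pos h2 2)]
      calc _ ≤ (4 * ‖1 - z * conj w‖) ^ 2 := by rw [one_mul]; gcongr
        _ = _ := by ring
    refine (ENNReal.ofReal_le_ofReal h4).trans (le_of_eq ?_)
    rw [ENNReal.ofReal_mul (by norm_num), ENNReal.ofReal_ofNat, sqKernel]
  have hm := measurable_sqKernel_left v
  calc ∫⁻ z in E, sqKernel z w ∂diskArea ≤ ∫⁻ z in E, 16 * sqKernel z v ∂diskArea :=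
        setLIntegral_mono' hE hcomp
    _ = 16 * ∫⁻ z in E, sqKernel z v ∂diskArea :=
        lintegral_const_mul _ hm
    _ ≤ 16 * C := by gcongr; exact hC v hv

/-- Every set has a subset of at least half its measure on which the potential with kernel
`|1 - z w̄|⁻²` is bounded. -/
theorem exists_subset_setLIntegral_sqKernel_le {E : Set ℂ} (hE : MeasurableSet E) :
    ∃ E' ⊆ E, MeasurableSet E' ∧ diskArea E ≤ 2 * diskArea E' ∧
      ∀ w ∈ Metric.ball (0 : ℂ) 1, ∫⁻ z in E', sqKernel z w ∂diskArea ≤ 128 := by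
  set U : ℂ → ℝ≥0∞ := fun w ↦ ∫⁻ z in E, sqKernel z w ∂diskArea with hU
  have hUm : Measurable U := measurable_sqKernel.lintegral_prod_left'
  have hmeas : MeasurableSet (E ∩ {w | U w < 8} ∩ Metric.ball 0 1) :=
    (hE.inter (hUm measurableSet_Iio)).inter measurableSet_ball
  refine ⟨E ∩ {w | U w < 8} ∩ Metric.ball 0 1, inter_subset_left.trans inter_subset_left,
    hmeas, ?_, ?_⟩
  · have hbig : diskArea (E ∩ {w | 8 ≤ U w}) ≤ diskArea E / 2 := by
      have h1 := mul_meas_ge_le_lintegral (μ := diskArea.restrict E) hUm 8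
      rw [Measure.restrict_apply (measurableSet_le measurable_const hUm), inter_comm] at h1
      have h2 := h1.trans (setLIntegral_setLIntegral_sqKernel_le E)
      rw [ENNReal.le_div_iff_mul_le (by simp) (by simp)]
      have h3 : (4 : ℝ≥0∞) * (diskArea (E ∩ {w | 8 ≤ U w}) * 2) ≤ 4 * diskArea E := by
        refine le_trans (le_of_eq ?_) h2
        rw [mul_comm _ (2 : ℝ≥0∞), ← mul_assoc]; norm_num
      exact (ENNReal.mul_le_mul_iff_right (by simp) (by simp)).1 h3
    have hball : diskArea (E ∩ {w | U w < 8} ∩ Metric.ball 0 1) = diskArea (E ∩ {w | U w < 8}) := by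
      refine measure_congr ?_
      filter_upwards [ae_mem_ball_diskArea] with z hz
      exact propext ⟨fun h ↦ h.1, fun h ↦ ⟨h, hz⟩⟩
    rw [hball]
    have hsplit : diskArea E ≤ diskArea (E ∩ {w | U w < 8}) + diskArea E / 2 := by
      calc diskArea E ≤ diskArea (E ∩ {w | U w < 8}) + diskArea (E ∩ {w | 8 ≤ U w}) := by
            refine (measure_mono ?_).trans (measure_union_le _ _)
            intro z hz
            rcases lt_or_ge (U z) 8 with h | h
            · exact Or.inl ⟨hz, h⟩
            · exact Or.inr ⟨hz, h⟩
        _ ≤ _ := by gcongr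
    have hfin : diskArea E ≠ ∞ := measure_ne_top _ _
    have hfin' : diskArea (E ∩ {w | U w < 8}) ≠ ∞ := measure_ne_top _ _
    rw [← ENNReal.toReal_le_toReal hfin (by finiteness)] at hsplit ⊢
    rw [ENNReal.toReal_add (by finiteness) (by finiteness), ENNReal.toReal_div] at hsplit
    rw [ENNReal.toReal_mul]
    simp only [ENNReal.toReal_ofNat] at hsplit ⊢
    linarith
  · intro w hw
    refine (setLIntegral_sqKernel_le_of_forall_mem (C := 8) hmeas inter_subset_right ?_ hw).trans
      (le_of_eq (by norm_num))
    intro v hv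
    exact (lintegral_mono_set (inter_subset_left.trans inter_subset_left)).trans hv.1.2.le

/-! ### From kernel bounds to weak-type bounds -/

theorem measurable_kernel (ν : Measure I) [IsFiniteMeasure ν] :
    Measurable fun p : ℂ × ℂ ↦ kernel ν p.1 p.2 := by
  have h1 : Measurable fun p : ℂ × ℂ ↦ 1 - p.1 * conj p.2 :=
    (by fun_prop : Continuous fun p : ℂ × ℂ ↦ 1 - p.1 * conj p.2).measurable
  have h2 : Measurable fun q : (ℂ × ℂ) × I ↦ 1 - ((q.2 : ℝ) : ℂ) * q.1.1 * conj q.1.2 :=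
    (by fun_prop :
      Continuous fun q : (ℂ × ℂ) × I ↦ 1 - ((q.2 : ℝ) : ℂ) * q.1.1 * conj q.1.2).measurable
  have h3 : StronglyMeasurable fun p : ℂ × ℂ ↦
      ∫ r : I, 1 / (1 - ((r : ℝ) : ℂ) * p.1 * conj p.2) ∂ν :=
    (h2.const_div 1).stronglyMeasurable.integral_prod_right'
  exact (h1.const_div 1).mul h3.measurable

theorem aestronglyMeasurable_shimorinOp (ν : Measure I) [IsFiniteMeasure ν] {f : ℂ → ℂ}
    (hf : AEStronglyMeasurable f diskArea) :
    AEStronglyMeasurable (shimorinOp ν f) diskArea := by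
  have h : AEStronglyMeasurable (fun p : ℂ × ℂ ↦ kernel ν p.1 p.2 * f p.2)
      (diskArea.prod diskArea) :=
    (measurable_kernel ν).aestronglyMeasurable.mul hf.comp_snd
  exact h.integral_prod_right'

theorem weakNorm_le_of_forall {p : ℝ} (hp : 0 < p) {g : ℂ → ℂ} {N : ℝ≥0∞}
    (h : ∀ t : ℝ, 0 < t → diskArea {z | t < ‖g z‖} ≤ N ^ p / ENNReal.ofReal t ^ p) :
    weakNorm p g ≤ N := by
  refine le_of_forall_gt_imp_ge_of_dense fun b hb ↦ sInf_le ⟨pos_of_gt hb, fun t ht ↦ ?_⟩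
  refine (h t ht).trans ?_
  have := hb.le
  gcongr

theorem measure_le_div_of_mul_le_mul_rpow {p : ℝ} (hp : 0 < p) {a m N : ℝ≥0∞}
    (ha : a ≠ 0) (ha' : a ≠ ∞) (hm : m ≠ ∞) (h : a * m ≤ N * m ^ (1 - 1 / p)) :
    m ≤ N ^ p / a ^ p := by
  rcases eq_or_ne m 0 with h0 | h0
  · simp [h0]
  have h1 : m ^ (1 / p) * m ^ (1 - 1 / p) = m := by
    rw [← ENNReal.rpow_add _ _ h0 hm]; simp
  have h2 : m ^ (1 - 1 / p) ≠ 0 := (ENNReal.rpow_pos (pos_iff_ne_zero.2 h0) hm).ne'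
  have h3 : m ^ (1 - 1 / p) ≠ ∞ := by
    intro h3
    rcases ENNReal.rpow_eq_top_iff.1 h3 with h4 | h4
    · exact h0 h4.1
    · exact hm h4.1
  have h4 : a * m ^ (1 / p) ≤ N := by
    rw [← ENNReal.mul_le_mul_iff_left h2 h3, mul_assoc, h1]
    exact h
  have h5 : m ^ (1 / p) ≤ N / a := by
    rw [ENNReal.le_div_iff_mul_le (Or.inl ha) (Or.inl ha'), mul_comm]
    exact h4
  have h6 := ENNReal.rpow_le_rpow h5 hp.le
  rwa [← ENNReal.rpow_mul, one_div_mul_cancel hp.ne', ENNReal.rpow_one,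
    ENNReal.div_rpow_of_nonneg _ _ hp.le] at h6

/-- A kernel bounded by `|1 - z w̄|^(-2/p)` gives a weak-type operator, once potentials on large
subsets are controlled. -/
theorem weakBounded_of_kernel_le {ν : Measure I} [IsFiniteMeasure ν] {p : ℝ} (hp : 0 < p)
    {A B : ℝ≥0}
    (hB : ∀ z ∈ Metric.ball (0 : ℂ) 1, ∀ w ∈ Metric.ball (0 : ℂ) 1,
      ‖kernel ν z w‖ₑ ≤ B * ENNReal.ofReal (‖1 - z * conj w‖ ^ (-(2 / p))))
    (hA : ∀ E, MeasurableSet E → ∃ E' ⊆ E, MeasurableSet E' ∧ diskArea E ≤ 2 * diskArea E' ∧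
      ∀ w ∈ Metric.ball (0 : ℂ) 1,
        ∫⁻ z in E', ENNReal.ofReal (‖1 - z * conj w‖ ^ (-(2 / p))) ∂diskArea ≤
          A * diskArea E ^ (1 - 1 / p)) :
    WeakBounded ν p := by
  refine ⟨2 * (B * A), fun f hf ↦ ?_⟩
  have hfm := hf.aestronglyMeasurable
  have hT := aestronglyMeasurable_shimorinOp ν hfm
  refine ⟨hT, weakNorm_le_of_forall hp fun t ht ↦ ?_⟩
  -- A measurable representative makes the level set measurable.
  set g := hT.mk (shimorinOp ν f) with hg
  set E : Set ℂ := {z | t < ‖g z‖} with hE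
  have hEm : MeasurableSet E :=
    measurableSet_lt measurable_const hT.stronglyMeasurable_mk.measurable.norm
  have hmeas : diskArea {z | t < ‖shimorinOp ν f z‖} ≤ diskArea E := by
    refine measure_mono_ae ?_
    filter_upwards [hT.ae_eq_mk] with z hz h
    have h' : t < ‖shimorinOp ν f z‖ := h
    rw [hz] at h'
    exact h'
  refine hmeas.trans ?_
  obtain ⟨E', hE'E, hE'm, hE'2, hE'A⟩ := hA E hEm
  set k : ℂ → ℂ → ℝ≥0∞ := fun z w ↦ ENNReal.ofReal (‖1 - z * conj w‖ ^ (-(2 / p))) with hk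
  have hkm : Measurable fun q : ℂ × ℂ ↦ k q.1 q.2 := measurable_norm_one_sub_rpow _
  have hkm1 : ∀ w, Measurable fun z ↦ k z w := fun w ↦ Measurable.of_uncurry_right hkm
  have hbound : ∀ z ∈ Metric.ball (0 : ℂ) 1,
      ‖shimorinOp ν f z‖ₑ ≤ ∫⁻ w, B * k z w * ‖f w‖ₑ ∂diskArea := by
    intro z hz
    refine (enorm_integral_le_lintegral_enorm _).trans (lintegral_mono_ae ?_)
    filter_upwards [ae_mem_ball_diskArea] with w hw
    rw [enorm_mul]
    gcongr
    exact hB z hz w hw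
  have hlow : ENNReal.ofReal t * diskArea E' ≤ ∫⁻ z in E', ‖shimorinOp ν f z‖ₑ ∂diskArea := by
    rw [← setLIntegral_const]
    refine lintegral_mono_ae ?_
    filter_upwards [ae_restrict_of_ae hT.ae_eq_mk, ae_restrict_mem hE'm] with z hz hzE
    rw [hz, ← ofReal_norm]
    exact ENNReal.ofReal_le_ofReal (le_of_lt (hE'E hzE))
  have hup : ∫⁻ z in E', ‖shimorinOp ν f z‖ₑ ∂diskArea ≤
      B * (A * diskArea E ^ (1 - 1 / p)) * eLpNorm f 1 diskArea := by
    calc _ ≤ ∫⁻ z in E', ∫⁻ w, B * k z w * ‖f w‖ₑ ∂diskArea ∂diskArea := by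
          refine lintegral_mono_ae ?_
          filter_upwards [ae_restrict_of_ae ae_mem_ball_diskArea] with z hz using hbound z hz
      _ = ∫⁻ w, ∫⁻ z in E', B * k z w * ‖f w‖ₑ ∂diskArea ∂diskArea := by
          refine lintegral_lintegral_swap ?_
          exact (hkm.const_mul _).aemeasurable.mul hfm.enorm.comp_snd
      _ ≤ ∫⁻ w, B * (A * diskArea E ^ (1 - 1 / p)) * ‖f w‖ₑ ∂diskArea := by
          refine lintegral_mono_ae ?_
          filter_upwards [ae_mem_ball_diskArea] with w hw
          rw [lintegral_mul_const _ ((hkm1 w).const_mul _), lintegral_const_mul _ (hkm1 w)]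
          gcongr
          exact hE'A w hw
      _ = _ := by
          rw [lintegral_const_mul'' _ hfm.enorm, eLpNorm_one_eq_lintegral_enorm]
  refine measure_le_div_of_mul_le_mul_rpow hp (by simpa using ht) ENNReal.ofReal_ne_top
    (measure_ne_top _ _) ?_
  calc ENNReal.ofReal t * diskArea E ≤ ENNReal.ofReal t * (2 * diskArea E') := by gcongr
    _ = 2 * (ENNReal.ofReal t * diskArea E') := by ring
    _ ≤ 2 * (B * (A * diskArea E ^ (1 - 1 / p)) * eLpNorm f 1 diskArea) :=
        mul_le_mul_right (hlow.trans hup) _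
    _ = _ := by push_cast; ring

theorem weakBounded_of_kernel_le_of_one_lt {ν : Measure I} [IsFiniteMeasure ν] {p : ℝ}
    (hp : 1 < p) {B : ℝ≥0}
    (hB : ∀ z ∈ Metric.ball (0 : ℂ) 1, ∀ w ∈ Metric.ball (0 : ℂ) 1,
      ‖kernel ν z w‖ₑ ≤ B * ENNReal.ofReal (‖1 - z * conj w‖ ^ (-(2 / p)))) :
    WeakBounded ν p := by
  refine weakBounded_of_kernel_le (A := (1 + 4 / (p - 1)).toNNReal) (by linarith) hB
    fun E hE ↦ ⟨E, subset_rfl, hE, ?_, fun w hw ↦ setLIntegral_norm_one_sub_rpow_le hp hw E⟩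
  rw [two_mul]
  exact le_self_add

/-! ### Sufficiency: upper bounds for the kernel -/

theorem enorm_kernel_le (ν : Measure I) (z w : ℂ) :
    ‖kernel ν z w‖ₑ ≤ ENNReal.ofReal ‖1 - z * conj w‖⁻¹ *
      ∫⁻ r : I, ENNReal.ofReal ‖1 - ((r : ℝ) : ℂ) * (z * conj w)‖⁻¹ ∂ν := by
  rw [kernel, enorm_mul]
  gcongr
  · rw [← ofReal_norm, norm_div, norm_one, one_div]
  · refine (enorm_integral_le_lintegral_enorm _).trans (lintegral_mono fun r ↦ ?_)
    rw [← ofReal_norm, norm_div, norm_one, one_div, mul_assoc]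

theorem norm_one_sub_mul_pos {z w : ℂ} (hz : z ∈ Metric.ball (0 : ℂ) 1)
    (hw : w ∈ Metric.ball (0 : ℂ) 1) : 0 < ‖1 - z * conj w‖ :=
  norm_pos_iff.2 (one_sub_ne_zero (norm_mul_conj_lt_one hz hw))

theorem inv_norm_one_sub_mul_le {z w : ℂ} (hz : z ∈ Metric.ball (0 : ℂ) 1)
    (hw : w ∈ Metric.ball (0 : ℂ) 1) (r : I) :
    ‖1 - ((r : ℝ) : ℂ) * (z * conj w)‖⁻¹ ≤ 2 * ‖1 - z * conj w‖⁻¹ := by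
  have h1 := norm_one_sub_mul_pos hz hw
  have h2 := norm_one_sub_le_two_mul (norm_mul_conj_lt_one hz hw).le r.2.1 r.2.2
  rw [← div_eq_mul_inv, inv_eq_one_div, div_le_div_iff₀ (by linarith) h1]
  linarith

theorem weakBounded_one (ν : Measure I) [IsFiniteMeasure ν] : WeakBounded ν 1 := by
  refine weakBounded_of_kernel_le (A := 128) (B := 2 * (ν univ).toNNReal) one_pos ?_ ?_
  · intro z hz w hw
    have hpos := norm_one_sub_mul_pos hz hw
    refine (enorm_kernel_le ν z w).trans ?_
    have h1 : ∫⁻ r : I, ENNReal.ofReal ‖1 - ((r : ℝ) : ℂ) * (z * conj w)‖⁻¹ ∂ν ≤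
        ENNReal.ofReal (2 * ‖1 - z * conj w‖⁻¹) * ν univ := by
      rw [← lintegral_const]
      exact lintegral_mono fun r ↦ ENNReal.ofReal_le_ofReal (inv_norm_one_sub_mul_le hz hw r)
    have h2 : ‖1 - z * conj w‖ ^ (-(2 / 1) : ℝ) = ‖1 - z * conj w‖⁻¹ * ‖1 - z * conj w‖⁻¹ := by
      rw [div_one, Real.rpow_neg hpos.le, Real.rpow_two, pow_two, mul_inv]
    refine (mul_le_mul_right h1 _).trans (le_of_eq ?_)
    rw [h2, ENNReal.ofReal_mul (by norm_num), ENNReal.ofReal_mul (by positivity),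
      ENNReal.coe_mul, ENNReal.coe_toNNReal (measure_ne_top _ _), ENNReal.ofReal_ofNat]
    push_cast
    ring
  · intro E hE
    obtain ⟨E', h1, h2, h3, h4⟩ := exists_subset_setLIntegral_sqKernel_le hE
    refine ⟨E', h1, h2, h3, fun w hw ↦ ?_⟩
    simpa [sqKernel] using h4 w hw

theorem weakBounded_two_of_lintegral_lt_top {ν : Measure I} [IsFiniteMeasure ν]
    (h : ∫⁻ r : I, ENNReal.ofReal (1 - (r : ℝ))⁻¹ ∂ν ≠ ∞)
    (h1 : ∀ᵐ r : I ∂ν, (r : ℝ) < 1) : WeakBounded ν 2 := by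
  refine weakBounded_of_kernel_le_of_one_lt (B := (∫⁻ r : I, ENNReal.ofReal (1 - (r : ℝ))⁻¹ ∂ν).toNNReal)
    one_lt_two fun z hz w hw ↦ ?_
  have hpos := norm_one_sub_mul_pos hz hw
  refine (enorm_kernel_le ν z w).trans ?_
  rw [ENNReal.coe_toNNReal h, mul_comm, div_self two_ne_zero, Real.rpow_neg_one]
  gcongr ?_ * _
  refine lintegral_mono_ae ?_
  filter_upwards [h1] with r hr
  refine ENNReal.ofReal_le_ofReal (inv_anti₀ (by linarith) ?_)
  exact one_sub_le_norm_one_sub_mul (norm_mul_conj_lt_one hz hw).le r.2.1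

/-- Layer cake: the Carleson bound controls the level sets by `M t^(-β)`, integrable at 0 because `β
< 1`, and they are empty above `2/|1 - z w̄|`. -/
theorem lintegral_inv_le_of_carleson {ν : Measure I} [IsFiniteMeasure ν] {β M : ℝ} (hβ0 : 0 < β)
    (hβ : β < 1) (hM : 0 ≤ M)
    (hν : ∀ t : ℝ, 0 < t → t ≤ 1 → ν {r : I | 1 - t ≤ (r : ℝ)} ≤ ENNReal.ofReal (M * t ^ β))
    {z w : ℂ} (hz : z ∈ Metric.ball (0 : ℂ) 1) (hw : w ∈ Metric.ball (0 : ℂ) 1) :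
    ∫⁻ r : I, ENNReal.ofReal ‖1 - ((r : ℝ) : ℂ) * (z * conj w)‖⁻¹ ∂ν ≤
      ENNReal.ofReal (M * 2 ^ (1 - β) / (1 - β) * ‖1 - z * conj w‖ ^ (β - 1)) := by
  have hpos := norm_one_sub_mul_pos hz hw
  set T : ℝ := 2 * ‖1 - z * conj w‖⁻¹ with hT
  have hT0 : 0 < T := by positivity
  have hν' : ∀ t : ℝ, 0 < t →
      ν {r : I | t < ‖1 - ((r : ℝ) : ℂ) * (z * conj w)‖⁻¹} ≤ ENNReal.ofReal (M * t ^ (-β)) := by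
    intro t ht
    rcases le_or_gt 1 t with h1 | h1
    · have h2 := hν t⁻¹ (by positivity) (inv_le_one_of_one_le₀ h1)
      rw [Real.inv_rpow ht.le, ← Real.rpow_neg ht.le] at h2
      refine (measure_mono fun r hr ↦ ?_).trans h2
      have hr' : t < ‖1 - ((r : ℝ) : ℂ) * (z * conj w)‖⁻¹ := hr
      have h3 := one_sub_le_norm_one_sub_mul (norm_mul_conj_lt_one hz hw).le r.2.1
      have h4 := (lt_inv_comm₀ ht (inv_pos.1 (ht.trans hr'))).1 hr'
      change 1 - t⁻¹ ≤ (r : ℝ)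
      linarith
    -- For `t < 1` the scale `1/t` is out of range; the total mass is at most `M ≤ M t^(-β)`.
    · have h2 := hν 1 one_pos le_rfl
      rw [Real.one_rpow, mul_one] at h2
      refine (measure_mono fun r _ ↦ ?_).trans (h2.trans (ENNReal.ofReal_le_ofReal ?_))
      · change 1 - 1 ≤ (r : ℝ)
        rw [sub_self]; exact r.2.1
      · exact le_mul_of_one_le_right hM (Real.one_le_rpow_of_pos_of_le_one_of_nonpos ht h1.le
          (by linarith))
  have hcont : Continuous fun r : I ↦ ‖1 - ((r : ℝ) : ℂ) * (z * conj w)‖ := by fun_prop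
  rw [lintegral_eq_lintegral_meas_lt ν
    (Filter.Eventually.of_forall fun r ↦ inv_nonneg.2 (norm_nonneg _))
    hcont.measurable.inv.aemeasurable, ← Ioc_union_Ioi_eq_Ioi hT0.le,
    lintegral_union measurableSet_Ioi (Ioc_disjoint_Ioi le_rfl)]
  have hzero : ∫⁻ t in Ioi T, ν {r : I | t < ‖1 - ((r : ℝ) : ℂ) * (z * conj w)‖⁻¹} = 0 := by
    rw [setLIntegral_congr_fun (g := fun _ ↦ 0) measurableSet_Ioi]
    · simp
    · intro t ht
      have : {r : I | t < ‖1 - ((r : ℝ) : ℂ) * (z * conj w)‖⁻¹} = ∅ := by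
        refine eq_empty_of_forall_notMem fun r hr ↦ ?_
        exact absurd (lt_of_lt_of_le hr (inv_norm_one_sub_mul_le hz hw r)) (not_lt.2 (le_of_lt ht))
      simp only [this, measure_empty]
  rw [hzero, add_zero]
  have hint : IntegrableOn (fun t : ℝ ↦ M * t ^ (-β)) (Ioc 0 T) := by
    have := (intervalIntegral.intervalIntegrable_rpow' (a := 0) (b := T) (r := -β)
      (by linarith)).const_mul M
    rwa [intervalIntegrable_iff_integrableOn_Ioc_of_le hT0.le] at this
  calc _ ≤ ∫⁻ t in Ioc 0 T, ENNReal.ofReal (M * t ^ (-β)) :=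
        setLIntegral_mono' measurableSet_Ioc fun t ht ↦ hν' t ht.1
    _ = ENNReal.ofReal (∫ t in Ioc 0 T, M * t ^ (-β)) := by
        rw [ofReal_integral_eq_lintegral_ofReal hint]
        filter_upwards [ae_restrict_mem measurableSet_Ioc] with t ht
        have : 0 < t := ht.1
        positivity
    _ = _ := by
        rw [← intervalIntegral.integral_of_le hT0.le, intervalIntegral.integral_const_mul,
          integral_rpow (Or.inl (by linarith)), Real.zero_rpow (by linarith), sub_zero, hT,
          Real.mul_rpow (by norm_num) (by positivity), Real.inv_rpow hpos.le,
          ← Real.rpow_neg hpos.le]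
        congr 1
        rw [show -β + 1 = 1 - β by ring, show -(1 - β) = β - 1 by ring]
        ring

theorem weakBounded_of_carleson {ν : Measure I} [IsFiniteMeasure ν] {p M : ℝ} (hp1 : 1 < p)
    (hp2 : p < 2) (hM : 0 ≤ M)
    (hν : ∀ t : ℝ, 0 < t → t ≤ 1 →
      ν {r : I | 1 - t ≤ (r : ℝ)} ≤ ENNReal.ofReal (M * t ^ (2 - 2 / p))) :
    WeakBounded ν p := by
  have hp0 : 0 < p := by linarith
  have hβ0 : 0 < 2 - 2 / p := by
    have : 2 / p < 2 := by rw [div_lt_iff₀ hp0]; linarith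
    linarith
  have hβ1 : 2 - 2 / p < 1 := by
    have : 1 < 2 / p := by rw [lt_div_iff₀ hp0]; linarith
    linarith
  refine weakBounded_of_kernel_le_of_one_lt
    (B := (M * 2 ^ (1 - (2 - 2 / p)) / (1 - (2 - 2 / p))).toNNReal) hp1 fun z hz w hw ↦ ?_
  have hpos := norm_one_sub_mul_pos hz hw
  have hc : 0 ≤ M * 2 ^ (1 - (2 - 2 / p)) / (1 - (2 - 2 / p)) := by
    have : 0 < 1 - (2 - 2 / p) := by linarith
    positivity
  refine (enorm_kernel_le ν z w).trans
    ((mul_le_mul_right (lintegral_inv_le_of_carleson hβ0 hβ1 hM hν hz hw) _).trans (le_of_eq ?_))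
  rw [← ENNReal.ofReal_mul (by positivity), ENNReal.ofNNReal_toNNReal, ← ENNReal.ofReal_mul hc]
  congr 1
  rw [show -(2 / p) = -1 + ((2 - 2 / p) - 1) by ring, Real.rpow_add hpos, Real.rpow_neg_one]
  ring

/-! ### Necessity: testing on small discs -/

/-- Relative errors of `1/8` in each factor leave `uv` within `xy/3` of the positive number `xy`, so
no cancellation occurs in the kernel. -/
theorem le_re_one_div_mul_of_norm_sub_le {u v : ℂ} {x y : ℝ} (hx : 0 < x) (hy : 0 < y)
    (hu : ‖u - x‖ ≤ x / 8) (hv : ‖v - y‖ ≤ y / 8) : 1 / (4 * (x * y)) ≤ (1 / u * (1 / v)).re := by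
  have hX : 0 < x * y := mul_pos hx hy
  have hv' : ‖v‖ ≤ 9 / 8 * y := by
    have := norm_add_le (v - y) (y : ℂ)
    rw [sub_add_cancel, Complex.norm_real, Real.norm_of_nonneg hy.le] at this
    linarith
  have hc : ‖u * v - ((x * y : ℝ) : ℂ)‖ ≤ x * y / 3 := by
    have h1 : u * v - ((x * y : ℝ) : ℂ) = (u - x) * v + x * (v - y) := by push_cast; ring
    rw [h1]
    refine (norm_add_le _ _).trans ?_
    rw [norm_mul, norm_mul, Complex.norm_real, Real.norm_of_nonneg hx.le]
    have h2 := mul_le_mul hu hv' (norm_nonneg _) (by positivity)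
    have h3 := mul_le_mul_of_nonneg_left hv hx.le
    nlinarith
  have hre : 2 / 3 * (x * y) ≤ (u * v).re := by
    have := (abs_le.1 ((Complex.abs_re_le_norm _).trans hc)).1
    rw [Complex.sub_re, Complex.ofReal_re] at this
    linarith
  have hnorm : ‖u * v‖ ≤ 4 / 3 * (x * y) := by
    have := norm_add_le (u * v - ((x * y : ℝ) : ℂ)) ((x * y : ℝ) : ℂ)
    rw [sub_add_cancel, Complex.norm_real, Real.norm_of_nonneg hX.le] at this
    linarith
  have hpos : 0 < ‖u * v‖ := by
    have := Complex.re_le_norm (u * v)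
    linarith
  rw [one_div_mul_one_div, one_div (u * v), Complex.inv_re, Complex.normSq_eq_norm_sq,
    div_le_div_iff₀ (by positivity) (by positivity)]
  nlinarith [mul_le_mul hnorm hnorm hpos.le (by positivity)]

theorem norm_mul_conj_sub_le {s : ℝ} (hs : 0 < s) (hs1 : s ≤ 1) {z w : ℂ}
    (hz : z ∈ Metric.ball ((1 - s : ℝ) : ℂ) (s / 16))
    (hw : w ∈ Metric.ball ((1 - s : ℝ) : ℂ) (s / 16)) :
    ‖z * conj w - (((1 - s) ^ 2 : ℝ) : ℂ)‖ ≤ s / 8 := by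
  rw [mem_ball_iff_norm] at hz hw
  have h1 : z * conj w - (((1 - s) ^ 2 : ℝ) : ℂ) =
      (z - ((1 - s : ℝ) : ℂ)) * conj w + ((1 - s : ℝ) : ℂ) * conj (w - ((1 - s : ℝ) : ℂ)) := by
    rw [map_sub, Complex.conj_ofReal]; push_cast; ring
  have hw1 : ‖w‖ ≤ 1 := by
    have := norm_add_le (w - ((1 - s : ℝ) : ℂ)) ((1 - s : ℝ) : ℂ)
    rw [sub_add_cancel, Complex.norm_real, Real.norm_of_nonneg (by linarith)] at this
    linarith
  rw [h1]
  refine (norm_add_le _ _).trans ?_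
  rw [norm_mul, norm_mul, RCLike.norm_conj, RCLike.norm_conj, Complex.norm_real,
    Real.norm_of_nonneg (by linarith : (0 : ℝ) ≤ 1 - s)]
  nlinarith [mul_le_mul hz.le hw1 (norm_nonneg _) (by positivity),
    mul_le_mul (by linarith : 1 - s ≤ 1) hw.le (norm_nonneg _) zero_le_one]

theorem ball_one_sub_subset {s : ℝ} (hs : 0 < s) (hs1 : s ≤ 1) :
    Metric.ball ((1 - s : ℝ) : ℂ) (s / 16) ⊆ Metric.ball 0 1 := by
  refine Metric.ball_subset_ball' ?_
  rw [dist_zero_right, Complex.norm_real, Real.norm_of_nonneg (by linarith)]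
  linarith

theorem integrable_of_continuous {E : Type*} [NormedAddCommGroup E] (ν : Measure I)
    [IsFiniteMeasure ν] {g : I → E} (hg : Continuous g) : Integrable g ν :=
  hg.integrable_of_hasCompactSupport (HasCompactSupport.of_compactSpace g)

theorem continuous_one_div_one_sub_mul {ζ : ℂ} (h : ‖ζ‖ < 1) :
    Continuous fun r : I ↦ 1 / (1 - ((r : ℝ) : ℂ) * ζ) := by
  refine continuous_const.div (by fun_prop) fun r ↦ one_sub_ne_zero ?_
  rw [norm_mul, Complex.norm_real, Real.norm_of_nonneg r.2.1]
  exact mul_lt_one_of_nonneg_of_lt_one_right r.2.2 (norm_nonneg _) h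

/-- A regularization of `∫ (1 - r)⁻¹ dν(r)` at scale `s`. -/
noncomputable def regularizedIntegral (ν : Measure I) (s : ℝ) : ℝ :=
  ∫ r : I, 1 / ((1 - (r : ℝ)) + 2 * s) ∂ν

theorem continuous_one_div_one_sub_add {s : ℝ} (hs : 0 < s) :
    Continuous fun r : I ↦ 1 / ((1 - (r : ℝ)) + 2 * s) := by
  refine continuous_const.div (by fun_prop) fun r ↦ ?_
  have := r.2.2
  linarith

theorem le_re_kernel (ν : Measure I) [IsFiniteMeasure ν] {s : ℝ} (hs : 0 < s) (hs1 : s ≤ 1)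
    {z w : ℂ} (hz : z ∈ Metric.ball ((1 - s : ℝ) : ℂ) (s / 16))
    (hw : w ∈ Metric.ball ((1 - s : ℝ) : ℂ) (s / 16)) :
    1 / (8 * s) * regularizedIntegral ν s ≤ (kernel ν z w).re := by
  have hζ := norm_mul_conj_sub_le hs hs1 hz hw
  have hζ1 := norm_mul_conj_lt_one (ball_one_sub_subset hs hs1 hz) (ball_one_sub_subset hs hs1 hw)
  have hint : Integrable (fun r : I ↦ 1 / (1 - z * conj w) *
      (1 / (1 - ((r : ℝ) : ℂ) * (z * conj w)))) ν :=
    integrable_of_continuous ν ((continuous_one_div_one_sub_mul hζ1).const_mul _)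
  have hK : kernel ν z w = ∫ r : I, 1 / (1 - z * conj w) *
      (1 / (1 - ((r : ℝ) : ℂ) * (z * conj w))) ∂ν := by
    rw [integral_const_mul, kernel]
    simp only [mul_assoc]
  have hre : (kernel ν z w).re = ∫ r : I, (1 / (1 - z * conj w) *
      (1 / (1 - ((r : ℝ) : ℂ) * (z * conj w)))).re ∂ν := by
    rw [hK]
    exact (integral_re hint).symm
  rw [hre, regularizedIntegral, ← integral_const_mul]
  refine integral_mono
    ((integrable_of_continuous ν (continuous_one_div_one_sub_add hs)).const_mul _) hint.re
    fun r ↦ ?_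
  have hr0 := r.2.1
  have hr1 := r.2.2
  -- `a` is the value of `z w̄` at the centre. Since `s ≤ 1 - a ≤ 1 - ra`, the deviation `s/8` is a
  -- relative error of at most `1/8` in both denominators.
  set a : ℝ := (1 - s) ^ 2 with ha
  have hx : s ≤ 1 - a := by rw [ha]; nlinarith
  have ha0 : 0 ≤ a := sq_nonneg _
  have hx2 : 1 - a ≤ 2 * s := by rw [ha]; nlinarith
  have hxy : 1 - a ≤ 1 - (r : ℝ) * a := by nlinarith
  have hy2 : 1 - (r : ℝ) * a ≤ (1 - (r : ℝ)) + 2 * s := by nlinarith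
  refine le_trans ?_ (le_re_one_div_mul_of_norm_sub_le (x := 1 - a) (y := 1 - (r : ℝ) * a)
    (by linarith) (by linarith) ?_ ?_)
  · rw [one_div_mul_one_div]
    refine one_div_le_one_div_of_le ?_ ?_
    · exact mul_pos (by norm_num) (mul_pos (by linarith) (by linarith))
    · have := mul_le_mul hx2 hy2 (by linarith) (by linarith)
      linarith
  · have : 1 - z * conj w - ((1 - a : ℝ) : ℂ) = -(z * conj w - (a : ℂ)) := by push_cast; ring
    rw [this, norm_neg]
    linarith
  · have : 1 - ((r : ℝ) : ℂ) * (z * conj w) - ((1 - (r : ℝ) * a : ℝ) : ℂ) =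
        -(((r : ℝ) : ℂ) * (z * conj w - (a : ℂ))) := by push_cast; ring
    rw [this, norm_neg, norm_mul, Complex.norm_real, Real.norm_of_nonneg hr0]
    have := mul_le_mul hr1 hζ (norm_nonneg _) zero_le_one
    linarith

theorem integrable_kernel (ν : Measure I) [IsFiniteMeasure ν] {z : ℂ}
    (hz : z ∈ Metric.ball (0 : ℂ) 1) : Integrable (fun w ↦ kernel ν z w) diskArea := by
  have hm : Measurable fun w ↦ kernel ν z w := (measurable_kernel ν).of_uncurry_left
  have hz' := mem_ball_zero_iff.1 hz
  refine Integrable.of_bound hm.aestronglyMeasurable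
    ((1 - ‖z‖)⁻¹ * ((1 - ‖z‖)⁻¹ * ν.real univ)) ?_
  have hlow : ∀ ρ : ℝ, 0 ≤ ρ → ρ ≤ 1 → ∀ w ∈ Metric.ball (0 : ℂ) 1,
      ‖1 / (1 - (ρ : ℂ) * z * conj w)‖ ≤ (1 - ‖z‖)⁻¹ := by
    intro ρ h0 h1 w hw
    rw [norm_div, norm_one, one_div]
    refine inv_anti₀ (by linarith) ?_
    have h2 := norm_sub_norm_le (1 : ℂ) ((ρ : ℂ) * z * conj w)
    rw [norm_one, norm_mul, norm_mul, Complex.norm_real, Real.norm_of_nonneg h0,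
      RCLike.norm_conj] at h2
    have h3 : ρ * ‖z‖ * ‖w‖ ≤ 1 * ‖z‖ * 1 := by
      have := (mem_ball_zero_iff.1 hw).le
      gcongr
    linarith
  filter_upwards [ae_mem_ball_diskArea] with w hw
  have hinv : 0 ≤ (1 - ‖z‖)⁻¹ := inv_nonneg.2 (by linarith)
  rw [kernel, norm_mul]
  refine mul_le_mul ?_ ?_ (norm_nonneg _) hinv
  · simpa using hlow 1 zero_le_one le_rfl w hw
  · exact norm_integral_le_of_norm_le_const
      (Filter.Eventually.of_forall fun r ↦ hlow r r.2.1 r.2.2 w hw)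

theorem le_norm_shimorinOp_indicator (ν : Measure I) [IsFiniteMeasure ν] {s : ℝ} (hs : 0 < s)
    (hs1 : s ≤ 1) {z : ℂ} (hz : z ∈ Metric.ball ((1 - s : ℝ) : ℂ) (s / 16)) :
    1 / (8 * s) * regularizedIntegral ν s * (s / 16) ^ 2 ≤
      ‖shimorinOp ν ((Metric.ball ((1 - s : ℝ) : ℂ) (s / 16)).indicator fun _ ↦ 1) z‖ := by
  set B := Metric.ball ((1 - s : ℝ) : ℂ) (s / 16) with hB
  have hsub : B ⊆ Metric.ball 0 1 := ball_one_sub_subset hs hs1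
  have hint := (integrable_kernel ν (hsub hz)).integrableOn (s := B)
  have hT : shimorinOp ν (B.indicator fun _ ↦ 1) z = ∫ w in B, kernel ν z w ∂diskArea := by
    rw [shimorinOp, ← integral_indicator measurableSet_ball]
    congr 1
    funext w
    by_cases hw : w ∈ B
    · rw [indicator_of_mem hw, indicator_of_mem hw, mul_one]
    · rw [indicator_of_notMem hw, indicator_of_notMem hw, mul_zero]
  have hvol : diskArea.real B = (s / 16) ^ 2 := by
    rw [Measure.real, diskArea_ball_eq (by positivity) hsub, ENNReal.toReal_ofReal (by positivity)]
  rw [hT]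
  refine le_trans ?_ (Complex.re_le_norm _)
  have hre : (∫ w in B, kernel ν z w ∂diskArea).re = ∫ w in B, (kernel ν z w).re ∂diskArea :=
    (integral_re hint).symm
  rw [hre, ← hvol]
  have hconst := setIntegral_mono_on (integrableOn_const (measure_ne_top diskArea B)) hint.re
    measurableSet_ball (fun w hw ↦ le_re_kernel ν hs hs1 hz hw)
  rw [setIntegral_const, smul_eq_mul, mul_comm] at hconst
  exact hconst

/-- On a disc of area `m ~ s²` the image of its indicator is at least `κ m`, with `κ` the kernel
bound, while the `L¹` norm is `m`. The weak bound gives `κ m^(1/p) ≲ 1`, that is, `κ ≲ s^(-2/p)`. -/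
theorem regularizedIntegral_le_of_weakBounded {ν : Measure I} [IsFiniteMeasure ν] {p : ℝ}
    (hp : 0 < p) (h : WeakBounded ν p) :
    ∃ D : ℝ, 0 ≤ D ∧ ∀ s : ℝ, 0 < s → s ≤ 1 →
      regularizedIntegral ν s ≤ D * s ^ (1 - 2 / p) := by
  obtain ⟨C, hC⟩ := h
  -- The first 16 is the kernel's 8 times 2 from halving the level to get a strict inequality; the
  -- second comes from the radius `s/16`. `C + 1` leaves room because the infimum in `weakNorm` need
  -- not be attained.
  refine ⟨16 * (C + 1) * 16 ^ (2 / p), by positivity, fun s hs hs1 ↦ ?_⟩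
  set B := Metric.ball ((1 - s : ℝ) : ℂ) (s / 16) with hB
  have hsub : B ⊆ Metric.ball 0 1 := ball_one_sub_subset hs hs1
  set m : ℝ := (s / 16) ^ 2 with hm
  have hm0 : 0 < m := by positivity
  have hBm : diskArea B = ENNReal.ofReal m := diskArea_ball_eq (by positivity) hsub
  set κ : ℝ := 1 / (8 * s) * regularizedIntegral ν s with hκ
  rcases le_or_gt κ 0 with hκ0 | hκ0
  · have : regularizedIntegral ν s ≤ 0 := by
      by_contra! hcon
      exact absurd hκ0 (not_le.2 (by positivity))
    exact this.trans (by positivity)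
  set f : ℂ → ℂ := B.indicator fun _ ↦ 1 with hf
  have hfL : MemLp f 1 diskArea := memLp_indicator_const 1 measurableSet_ball 1
    (Or.inr (measure_ne_top _ _))
  have hfn : eLpNorm f 1 diskArea = ENNReal.ofReal m := by
    rw [hf, eLpNorm_indicator_const measurableSet_ball one_ne_zero ENNReal.one_ne_top, hBm]
    simp
  obtain ⟨-, hw⟩ := hC f hfL
  rw [hfn] at hw
  have hlt : weakNorm p (shimorinOp ν f) < ENNReal.ofReal ((C + 1) * m) := by
    refine hw.trans_lt ?_
    rw [← ENNReal.ofReal_coe_nnreal, ← ENNReal.ofReal_mul C.coe_nonneg]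
    exact (ENNReal.ofReal_lt_ofReal_iff (by positivity)).2 (by nlinarith)
  obtain ⟨N, ⟨-, hN⟩, hNlt⟩ := sInf_lt_iff.1 hlt
  have hκm : 0 < κ * m / 2 := by positivity
  have h1 : ENNReal.ofReal m ≤ ENNReal.ofReal (((C + 1) * m / (κ * m / 2)) ^ p) := by
    rw [← ENNReal.ofReal_rpow_of_pos (by positivity), ENNReal.ofReal_div_of_pos hκm,
      ENNReal.div_rpow_of_nonneg _ _ hp.le, ← hBm]
    refine le_trans (measure_mono fun z hz ↦ ?_) ((hN _ hκm).trans ?_)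
    · have h2 := le_norm_shimorinOp_indicator ν hs hs1 hz
      change κ * m / 2 < ‖shimorinOp ν f z‖
      have h3 : 0 < κ * m := by positivity
      exact lt_of_lt_of_le (half_lt_self h3) h2
    · have := hNlt.le
      gcongr
  have h2 := (ENNReal.ofReal_le_ofReal_iff (by positivity)).1 h1
  have h3 : (C + 1) * m / (κ * m / 2) = 2 * (C + 1) / κ := by
    field_simp
  rw [h3] at h2
  have h4 := Real.rpow_le_rpow hm0.le h2 (by positivity : 0 ≤ 1 / p)
  rw [← Real.rpow_mul (by positivity), mul_one_div_cancel hp.ne', Real.rpow_one,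
    le_div_iff₀ hκ0] at h4
  have h5 : m ^ (1 / p) = s ^ (2 / p) / 16 ^ (2 / p) := by
    rw [hm, ← Real.rpow_natCast, ← Real.rpow_mul (by positivity), ← Real.div_rpow hs.le (by norm_num)]
    congr 1
    push_cast
    ring
  have h6 : κ = regularizedIntegral ν s / (8 * s) := by rw [hκ]; ring
  rw [h5, h6, div_mul_div_comm, div_le_iff₀ (by positivity)] at h4
  rw [Real.rpow_sub hs, Real.rpow_one, mul_div_assoc', le_div_iff₀ (by positivity)]
  linarith

/-- Chebyshev at scale `s = t`: the regularized integrand is at least `1/(3t)` where `1 - r ≤ t`.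
The endpoint `r = 1` is included. -/
theorem measure_le_of_weakBounded {ν : Measure I} [IsFiniteMeasure ν] {p : ℝ}
    (hp : 0 < p) (h : WeakBounded ν p) :
    ∃ D : ℝ, 0 ≤ D ∧ ∀ t : ℝ, 0 < t → t ≤ 1 →
      ν {r : I | 1 - t ≤ (r : ℝ)} ≤ ENNReal.ofReal (D * t ^ (2 - 2 / p)) := by
  obtain ⟨D, hD, h⟩ := regularizedIntegral_le_of_weakBounded hp h
  refine ⟨3 * D, by positivity, fun t ht ht1 ↦ ?_⟩
  have h1 := mul_meas_ge_le_integral_of_nonneg (μ := ν)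
    (f := fun r : I ↦ 1 / ((1 - (r : ℝ)) + 2 * t))
    (Filter.Eventually.of_forall fun r ↦ by
      have := r.2.2
      exact one_div_nonneg.2 (by linarith))
    (integrable_of_continuous ν (continuous_one_div_one_sub_add ht)) (1 / (3 * t))
  have h2 : ν.real {r : I | 1 - t ≤ (r : ℝ)} ≤
      ν.real {r : I | 1 / (3 * t) ≤ 1 / ((1 - (r : ℝ)) + 2 * t)} := by
    refine measureReal_mono fun r hr ↦ ?_
    have hr' : 1 - t ≤ (r : ℝ) := hr
    have := r.2.2
    change 1 / (3 * t) ≤ 1 / ((1 - (r : ℝ)) + 2 * t)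
    exact one_div_le_one_div_of_le (by linarith) (by linarith)
  have h3 : 1 / (3 * t) * ν.real {r : I | 1 - t ≤ (r : ℝ)} ≤ D * t ^ (1 - 2 / p) :=
    (mul_le_mul_of_nonneg_left h2 (by positivity)).trans (h1.trans (h t ht ht1))
  rw [one_div_mul_eq_div, div_le_iff₀ (by positivity)] at h3
  rw [← ENNReal.ofReal_toReal (measure_ne_top ν _)]
  refine ENNReal.ofReal_le_ofReal (h3.trans (le_of_eq ?_))
  rw [show 2 - 2 / p = (1 - 2 / p) + 1 by ring, Real.rpow_add_one ht.ne']
  ring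

theorem hyperbolicIntegrable_of_weakBounded {ν : Measure I} [IsFiniteMeasure ν]
    (h : WeakBounded ν 2) : HyperbolicIntegrable ν := by
  obtain ⟨D, hD, h⟩ := regularizedIntegral_le_of_weakBounded two_pos h
  have hbound : ∀ n : ℕ, ∫⁻ r : I, ENNReal.ofReal (1 / ((1 - (r : ℝ)) + 2 * (1 / ((n : ℝ) + 1)))) ∂ν
      ≤ ENNReal.ofReal D := by
    intro n
    have hn : (0 : ℝ) < 1 / ((n : ℝ) + 1) := by positivity
    have h1 := h _ hn (by
      rw [div_le_one (by positivity)]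
      have : (0 : ℝ) ≤ n := n.cast_nonneg
      linarith)
    rw [← ofReal_integral_eq_lintegral_ofReal
      (integrable_of_continuous ν (continuous_one_div_one_sub_add hn))]
    · refine ENNReal.ofReal_le_ofReal (h1.trans (le_of_eq ?_))
      norm_num
    · refine Filter.Eventually.of_forall fun r ↦ one_div_nonneg.2 ?_
      have := r.2.2
      linarith
  have hfatou := lintegral_liminf_le (μ := ν) (u := Filter.atTop) (f := fun (n : ℕ) (r : I) ↦
    ENNReal.ofReal (1 / ((1 - (r : ℝ)) + 2 * (1 / ((n : ℝ) + 1))))) fun n ↦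
      (continuous_one_div_one_sub_add (by positivity)).measurable.ennreal_ofReal
  have hle : Filter.liminf (fun n : ℕ ↦
      ∫⁻ r : I, ENNReal.ofReal (1 / ((1 - (r : ℝ)) + 2 * (1 / ((n : ℝ) + 1)))) ∂ν) Filter.atTop ≤
      ENNReal.ofReal D :=
    Filter.liminf_le_of_le (by isBoundedDefault) fun b hb ↦ by
      obtain ⟨n, hn⟩ := hb.exists
      exact hn.trans (hbound n)
  refine lt_of_le_of_lt ?_ (ENNReal.ofReal_lt_top (r := D))
  refine le_trans ?_ (hfatou.trans hle)
  refine le_trans ?_ (setLIntegral_le_lintegral {r : I | (r : ℝ) < 1} _)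
  refine setLIntegral_mono' (measurableSet_lt (by fun_prop) measurable_const) fun r hr ↦ ?_
  have hr1 : (r : ℝ) < 1 := hr
  have hr0 := r.2.1
  have hlim : Filter.Tendsto (fun n : ℕ ↦
      ENNReal.ofReal (1 / ((1 - (r : ℝ)) + 2 * (1 / ((n : ℝ) + 1))))) Filter.atTop
      (nhds (ENNReal.ofReal (1 / ((1 - (r : ℝ)) + 2 * 0)))) := by
    refine ENNReal.tendsto_ofReal (Filter.Tendsto.div tendsto_const_nhds ?_ (by linarith))
    exact tendsto_const_nhds.add (tendsto_one_div_add_atTop_nhds_zero_nat.const_mul 2)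
  rw [hlim.liminf_eq, mul_zero, add_zero, ENNReal.ofReal_div_of_pos (by linarith),
    ENNReal.ofReal_one]
  gcongr
  nlinarith

/-! ### The critical index and the conditions on `ν` -/

theorem twoOverDual_eq {c : ℝ} (hc : 1 ≤ c) : twoOverDual c = 2 - 2 / c := by
  rcases hc.eq_or_lt with rfl | hc
  · simp [twoOverDual, dualIndex, ENNReal.conjExponent]
  · have h1 : 0 < c - 1 := by linarith
    rw [twoOverDual, dualIndex, ENNReal.conjExponent, ← ENNReal.ofReal_one,
      ← ENNReal.ofReal_sub _ zero_le_one, ← ENNReal.ofReal_inv_of_pos h1,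
      ← ENNReal.ofReal_add zero_le_one (by positivity), ENNReal.toReal_div,
      ENNReal.toReal_ofReal (by positivity), ENNReal.toReal_ofNat]
    have : c ≠ 0 := by linarith
    field_simp
    ring

/-- Some admissible `c > 1` exists, and its integrand is infinite at `r = 1`. -/
theorem ae_lt_one_of_one_lt_criticalIndex {ν : Measure I} (h : 1 < criticalIndex ν) :
    ∀ᵐ r : I ∂ν, (r : ℝ) < 1 := by
  obtain ⟨c, ⟨-, -, hc⟩, hc1⟩ := exists_lt_of_lt_csSup (by
    by_contra! hempty
    rw [criticalIndex, hempty, Real.sSup_empty] at h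
    linarith) h
  have hpos : 0 < twoOverDual c := by
    rw [twoOverDual_eq hc1.le, sub_pos, div_lt_iff₀ (by linarith)]
    linarith
  have hm : Measurable fun r : I ↦ 1 / ENNReal.ofReal (1 - (r : ℝ) ^ 2) ^ twoOverDual c := by
    fun_prop
  filter_upwards [ae_lt_top hm hc.ne] with r hr
  refine lt_of_le_of_ne r.2.2 fun h1 ↦ ?_
  simp [h1, hpos] at hr

theorem exists_carleson_bound {ν : Measure I} {α : ℝ} (hν : ∀ᵐ r : I ∂ν, (r : ℝ) < 1)
    (h : IsCarleson ν α) :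
    ∃ M : ℝ, 0 ≤ M ∧ ∀ t : ℝ, 0 < t → t ≤ 1 →
      ν {r : I | 1 - t ≤ (r : ℝ)} ≤ ENNReal.ofReal (M * t ^ α) := by
  set M : ℝ≥0∞ := ⨆ t ∈ Ioc (0 : ℝ) 1,
    ν {r : I | 1 - t ≤ (r : ℝ) ∧ (r : ℝ) < 1} / ENNReal.ofReal (t ^ α) with hM
  have hMtop : M < ∞ := h
  refine ⟨M.toReal, ENNReal.toReal_nonneg, fun t ht ht1 ↦ ?_⟩
  have h1 : ν {r : I | 1 - t ≤ (r : ℝ) ∧ (r : ℝ) < 1} / ENNReal.ofReal (t ^ α) ≤ M :=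
    le_iSup₂ (f := fun t (_ : t ∈ Ioc (0 : ℝ) 1) ↦
      ν {r : I | 1 - t ≤ (r : ℝ) ∧ (r : ℝ) < 1} / ENNReal.ofReal (t ^ α)) t ⟨ht, ht1⟩
  have hpos : 0 < t ^ α := Real.rpow_pos_of_pos ht _
  rw [ENNReal.div_le_iff (by simpa using hpos) ENNReal.ofReal_ne_top] at h1
  rw [ENNReal.ofReal_mul ENNReal.toReal_nonneg, ENNReal.ofReal_toReal hMtop.ne]
  refine le_trans (measure_mono_ae ?_) h1
  filter_upwards [hν] with r hr hrt using ⟨hrt, hr⟩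

theorem isCarleson_of_measure_le {ν : Measure I} {α M : ℝ}
    (h : ∀ t : ℝ, 0 < t → t ≤ 1 → ν {r : I | 1 - t ≤ (r : ℝ)} ≤ ENNReal.ofReal (M * t ^ α)) :
    IsCarleson ν α := by
  refine lt_of_le_of_lt (iSup₂_le fun t ht ↦ ?_) (ENNReal.ofReal_lt_top (r := M))
  have hpos : 0 < t ^ α := Real.rpow_pos_of_pos ht.1 _
  rw [ENNReal.div_le_iff (by simpa using hpos) ENNReal.ofReal_ne_top,
    ← ENNReal.ofReal_mul' hpos.le]
  exact (measure_mono fun r hr ↦ hr.1).trans (h t ht.1 ht.2)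

theorem lintegral_inv_ne_top_of_hyperbolicIntegrable {ν : Measure I}
    (hν : ∀ᵐ r : I ∂ν, (r : ℝ) < 1) (h : HyperbolicIntegrable ν) :
    ∫⁻ r : I, ENNReal.ofReal (1 - (r : ℝ))⁻¹ ∂ν ≠ ∞ := by
  have hrestrict : ν.restrict {r : I | (r : ℝ) < 1} = ν :=
    Measure.restrict_eq_self_of_ae_mem hν
  rw [HyperbolicIntegrable, hrestrict] at h
  have hle : ∫⁻ r : I, ENNReal.ofReal (1 - (r : ℝ))⁻¹ ∂ν ≤
      ∫⁻ r : I, 2 * (1 / ENNReal.ofReal (1 - (r : ℝ) ^ 2)) ∂ν := by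
    refine lintegral_mono_ae ?_
    filter_upwards [hν] with r hr
    have hr0 := r.2.1
    have h1 : 0 < 1 - (r : ℝ) ^ 2 := by nlinarith
    rw [one_div, ← ENNReal.ofReal_inv_of_pos h1, ← ENNReal.ofReal_ofNat 2,
      ← ENNReal.ofReal_mul (by norm_num)]
    refine ENNReal.ofReal_le_ofReal ?_
    rw [← div_eq_mul_inv, inv_eq_one_div, div_le_div_iff₀ (by linarith) h1]
    nlinarith
  rw [lintegral_const_mul' _ _ ENNReal.ofNat_ne_top] at hle
  exact (hle.trans_lt (ENNReal.mul_lt_top ENNReal.ofNat_lt_top h)).ne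

end Shimorin

theorem mainTheorem4 (ν : Measure I) [IsFiniteMeasure ν] :
    ((1 ≤ Shimorin.criticalIndex ν ∧ Shimorin.criticalIndex ν < 2) →
      (Shimorin.WeakBounded ν (Shimorin.criticalIndex ν) ↔
        Shimorin.IsCarleson ν (Shimorin.twoOverDual (Shimorin.criticalIndex ν)))) ∧
    (Shimorin.criticalIndex ν = 2 →
      (Shimorin.WeakBounded ν 2 ↔ Shimorin.HyperbolicIntegrable ν)) := by
  refine ⟨fun ⟨h1, h2⟩ ↦ ⟨fun hw ↦ ?_, fun hC ↦ ?_⟩,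
    fun h ↦ ⟨Shimorin.hyperbolicIntegrable_of_weakBounded, fun hH ↦ ?_⟩⟩
  · obtain ⟨D, -, hD⟩ := Shimorin.measure_le_of_weakBounded (by linarith) hw
    rw [Shimorin.twoOverDual_eq h1]
    exact Shimorin.isCarleson_of_measure_le hD
  -- At `c_ν = 1` the Carleson hypothesis is not needed, and `ν` may charge `r = 1`.
  · rcases h1.eq_or_lt with h3 | h3
    · rw [← h3]
      exact Shimorin.weakBounded_one ν
    · rw [Shimorin.twoOverDual_eq h1] at hC
      obtain ⟨M, hM, hν⟩ := Shimorin.exists_carleson_bound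
        (Shimorin.ae_lt_one_of_one_lt_criticalIndex h3) hC
      exact Shimorin.weakBounded_of_carleson h3 h2 hM hν
  · have hν := Shimorin.ae_lt_one_of_one_lt_criticalIndex (h ▸ one_lt_two)
    exact Shimorin.weakBounded_two_of_lintegral_lt_top
      (Shimorin.lintegral_inv_ne_top_of_hyperbolicIntegrable hν hH) hν
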